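/- Let $\beta>1$ be a Pisot unit, that is, an algebraic integer whose minimal polynomial $g(x)=x^m-k_1x^{m-1}-\dots-k_m\in\mathbb Z[x]$ has $k_m=\pm1$ and whose conjugates other than $\beta$ have modulus $<1$. Assume that $\beta$ is finitary: an $x\in[0,1)$ has a finite $\beta$-expansion (greedy expansion $x=\sum_{k\ge1}\varepsilon_k\beta^{-k}$, $\varepsilon_1=\lfloor\beta x\rfloor$, $\varepsilon_2=\lfloor\beta\{\beta x\}\rfloor$, etc.) if and only if $x\in\mathbb Z[\beta]$. Let $(d'_n)_{n\ge1}$ be the greedy expansion of $1$; put $d=d'$ if $d'$ has infinitely many nonzero terms, and otherwise let $d$ be the periodic sequence with period $(d'_1,\dots,d'_{k-1},d'_k-1)$, where $d'_k$ is the last nonzero term. Let $X_\beta$ be the set of sequences $(\varepsilon_n)_{n\in\mathbb Z}$ of non-negative integers such that $(\varepsilon_n,\varepsilon_{n+1},\dots)$ is strictly smaller than $d$ in the lexicographic order for every $n\in\mathbb Z$. Let $T$ be the automorphism of the torus $\mathbb T^m=\mathbb R^m/\mathbb Z^m$ given by the companion matrix $M$ with first row $(k_1,\dots,k_m)$, ones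 just below the diagonal and zeros elsewhere. Put $\xi_0=1/g'(\beta)$, and, modulo $\mathbb Z^m$, $t=(1,\beta^{-1},\dots,\beta^{-m+1})$ and $t_0=(\xi_0,\xi_0\beta^{-1},\dots,\xi_0\beta^{-m+1})$. For $\varepsilon\in X_\beta$ let $$\varphi_0(\varepsilon)=\sum_{k\in\mathbb Z}\varepsilon_kT^{-k}t_0,\qquad \varphi(\varepsilon)=\sum_{k\in\mathbb Z}\varepsilon_kT^{-k}t .$$ Let $\beta_1=\beta,\beta_2,\dots,\beta_m$ be the conjugates of $\beta$ and $D(\beta)=\prod_{i<j}(\beta_i-\beta_j)^2$ its discriminant. Then both series converge for every $\varepsilon\in X_\beta$, and $\varphi\circ\varphi_0^{-1}$ is well defined almost everywhere on $\mathbb T^m$: for Haar-almost every $x$ there is exactly one $y$ such that $\varphi_0(\varepsilon)=x$ and $\varphi(\varepsilon)=y$ for some $\varepsilon\in X_\beta$. There is exactly one continuous map $A:\mathbb T^m\to\mathbb T^m$ that agrees with $\varphi\circ\varphi_0^{-1}$ almost everywhere. It is an endomorphism of the torus, given by a unique integer matrix $N$. For every $p\in\mathbb Z[x]$ with $p(\beta)=\xi_0^{-1}=g'(\beta)$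 one has $A=p(T)$ and $N=p(M)$. The determinant of $A$, that is $\det N$, equals $D(\beta)$ or $-D(\beta)$. -/

import Mathlib

open Polynomial MeasureTheory

noncomputable section

namespace PisotCoding

/-- The characteristic polynomial `g` of the algebraic integer `β`. -/
abbrev charPol (β : ℝ) : ℤ[X] := minpoly ℤ β

/-- The degree `m` of `β`. -/
abbrev deg (β : ℝ) : ℕ := (charPol β).natDegree

/-- `β > 1` is an algebraic integer all of whose other conjugates have modulus less than one. -/
structure IsPisot (β : ℝ) : Prop where
  one_lt : 1 < β
  isIntegral : IsIntegral ℤ β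
  norm_conj_lt : ∀ z : ℂ, aeval z (charPol β) = 0 → z ≠ (β : ℂ) → ‖z‖ < 1

/-- A Pisot number whose minimal polynomial has constant term `±1`. -/
structure IsPisotUnit (β : ℝ) : Prop extends IsPisot β where
  coeff_zero : (charPol β).coeff 0 = 1 ∨ (charPol β).coeff 0 = -1

/-- The digits given by the greedy algorithm in base `β`, indexed from `0`:
`⌊βx⌋, ⌊β{βx}⌋, …`. -/
def greedyDigit (β x : ℝ) (n : ℕ) : ℕ := ⌊β * (fun y : ℝ => Int.fract (β * y))^[n] x⌋₊

/-- The sequence has the tail `0^∞`. -/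
def EndsInZeros (s : ℕ → ℕ) : Prop := ∃ N, ∀ n, N ≤ n → s n = 0

/-- Those `x ∈ [0,1)` whose `β`-expansion is finite. -/
def finiteExpansions (β : ℝ) : Set ℝ := {x | x ∈ Set.Ico (0 : ℝ) 1 ∧ EndsInZeros (greedyDigit β x)}

/-- `Fin(β) = ℤ[β] ∩ [0,1)`. -/
def IsFinitary (β : ℝ) : Prop :=
  finiteExpansions β = (Algebra.adjoin ℤ {β} : Set ℝ) ∩ Set.Ico (0 : ℝ) 1

open Classical in
/-- The sequence `d`, indexed from `0`. It is the greedy expansion `d'` of `1` if that is not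
finite; otherwise, with `d'_0, …, d'_{k-1}` the part of `d'` up to its last nonzero digit, it is
the periodic sequence with period `d'_0, …, d'_{k-2}, d'_{k-1} - 1`. -/
def quasiGreedyOne (β : ℝ) : ℕ → ℕ :=
  if h : EndsInZeros (greedyDigit β 1) then
    fun n =>
      if n % Nat.find h + 1 = Nat.find h then greedyDigit β 1 (n % Nat.find h) - 1
      else greedyDigit β 1 (n % Nat.find h)
  else greedyDigit β 1

/-- Strict lexicographic order on one-sided sequences. -/
def LexLT (x y : ℕ → ℕ) : Prop := ∃ n, (∀ i < n, x i = y i) ∧ x n < y n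

/-- The two-sided `β`-compactum `X_β`. -/
def compactum (β : ℝ) : Set (ℤ → ℕ) :=
  {ε | ∀ n : ℤ, LexLT (fun j : ℕ => ε (n + j)) (quasiGreedyOne β)}

/-- The torus `ℝ^m / ℤ^m`. -/
abbrev Torus (m : ℕ) : Type := UnitAddTorus (Fin m)

/-- The endomorphism of the torus given by an integer matrix. -/
def toralEnd {m : ℕ} (N : Matrix (Fin m) (Fin m) ℤ) : AddMonoid.End (Torus m) :=
  AddMonoidHom.mk' (fun x i => ∑ j, N i j • x j) (by
    intro x y
    funext i
    simp [smul_add, Finset.sum_add_distrib])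

/-- The companion matrix `M(β)`: with `g = x^m - k_1 x^(m-1) - … - k_m`, its first row is
`k_1, …, k_m` and it has ones just below the diagonal. -/
def companion (β : ℝ) : Matrix (Fin (deg β)) (Fin (deg β)) ℤ :=
  Matrix.of fun i j =>
    if (i : ℕ) = 0 then -(charPol β).coeff (deg β - 1 - j)
    else if (i : ℕ) = j + 1 then 1 else 0

/-- The toral automorphism `T = T(β)`. -/
def T (β : ℝ) : AddMonoid.End (Torus (deg β)) := toralEnd (companion β)

/-- `T^k` for `k : ℤ`; `companion β` has determinant `±1` when `β` is a unit. -/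
def Tpow (β : ℝ) (k : ℤ) : AddMonoid.End (Torus (deg β)) := toralEnd (companion β ^ k)

/-- `ξ₀ = 1 / g'(β)`. -/
def xi₀ (β : ℝ) : ℝ := (aeval β (derivative (charPol β)))⁻¹

/-- The point `(ξ, ξβ⁻¹, …, ξβ^{-m+1})` of the torus. -/
def homoclinic (β ξ : ℝ) : Torus (deg β) :=
  fun i => ((ξ * β⁻¹ ^ (i : ℕ) : ℝ) : UnitAddCircle)

/-- The terms `ε_k T^{-k} t` of the coding series, for `t = (ξ, ξβ⁻¹, …)`. -/
def codingTerm (β ξ : ℝ) (ε : ℤ → ℕ) (k : ℤ) : Torus (deg β) :=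
  ε k • Tpow β (-k) (homoclinic β ξ)

/-- `ε ↦ ∑_{k ∈ ℤ} ε_k T^{-k} t`, for `t = (ξ, ξβ⁻¹, …)`. -/
def coding (β ξ : ℝ) (ε : ℤ → ℕ) : Torus (deg β) := ∑' k : ℤ, codingTerm β ξ ε k

/-- The coding `φ₀`. -/
def phi₀ (β : ℝ) : (ℤ → ℕ) → Torus (deg β) := coding β (xi₀ β)

/-- The coding `φ`. -/
def phi (β : ℝ) : (ℤ → ℕ) → Torus (deg β) := coding β 1

/-- `y` is a value of `φ ∘ φ₀⁻¹` at `x`. -/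
def IsValue (β : ℝ) (x y : Torus (deg β)) : Prop :=
  ∃ ε ∈ compactum β, phi₀ β ε = x ∧ phi β ε = y

/-- `A` is continuous and agrees with `φ ∘ φ₀⁻¹` almost everywhere for Haar measure. -/
def IsContinuousExtension (β : ℝ) (A : Torus (deg β) → Torus (deg β)) : Prop :=
  Continuous A ∧ ∀ᵐ x ∂(volume : Measure (Torus (deg β))), IsValue β x (A x)

/-- The discriminant `∏_{i<j} (β_i - β_j)²` of the numbers `β_1, …, β_m`. -/
def discriminant {m : ℕ} (b : Fin m → ℂ) : ℂ := ∏ i, ∏ j ∈ Finset.Ioi i, (b i - b j) ^ 2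

end PisotCoding

end

/-!
Since `g'(β) ξ₀ = 1`, the matrix `g'(M)` maps `t₀` to `t`, so `φ = g'(T) ∘ φ₀` term by term as soon
as `φ₀` converges, and `det g'(M) = ∏ᵢ g'(βᵢ)` is the discriminant up to sign. It remains to show
that `φ₀` is almost surjective.

By Euler's formula the numbers `∑ᵢ βᵢ ^ j / g'(βᵢ)` are integers for all `j : ℤ`; hence `ξ₀ β ^ j`
is exponentially close to an integer as `j → ∞`, which gives the convergence. The greedy expansions
of the numbers `s ≥ 0` show that `φ₀(X_β)` contains the ray `s ↦ s t₀`, which is dense because the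
coordinates of `t₀` are rationally independent; so `φ₀` maps the compact closure of `X_β` onto the
torus. A point of this closure outside `X_β` has `d` as a tail. The digits left of that tail
contribute lifts in the contracting hyperplane of `M`, so `φ₀` maps all such points into the
projections of countably many affine hyperplanes, a null set.
-/

noncomputable section

namespace PisotCoding

section Roots

variable {R K ι : Type*} [CommRing R] [Field K] [Algebra R K] {g : R[X]} {s : Finset ι} {v : ι → K}

theorem aeval_eq_zero_iff_of_map_eq_prod (hg : g.map (algebraMap R K) = ∏ i ∈ s, (X - C (v i)))
    (z : K) : aeval z g = 0 ↔ ∃ i ∈ s, z = v i := by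
  rw [← eval_map_algebraMap, hg, eval_prod, Finset.prod_eq_zero_iff]
  simp only [eval_sub, eval_X, eval_C, sub_eq_zero]

theorem aeval_derivative_of_map_eq_prod [DecidableEq ι]
    (hg : g.map (algebraMap R K) = ∏ i ∈ s, (X - C (v i))) {i : ι} (hi : i ∈ s) :
    aeval (v i) (derivative g) = ∏ j ∈ s.erase i, (v i - v j) := by
  rw [← eval_map_algebraMap, ← derivative_map, hg]
  exact (Lagrange.eval_nodal_derivative_eval_node_eq hi).trans (Lagrange.eval_nodal ..)

/-- Euler's formula. -/
theorem sum_aeval_div_aeval_derivative (hm : g.Monic)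
    (hg : g.map (algebraMap R K) = ∏ i ∈ s, (X - C (v i))) (hv : Set.InjOn v s) (P : R[X]) :
    ∑ i ∈ s, aeval (v i) P / aeval (v i) (derivative g) =
      algebraMap R K ((P %ₘ g).coeff (s.card - 1)) := by
  classical
  have hdeg : ((P %ₘ g).map (algebraMap R K)).degree < s.card := by
    refine degree_map_le.trans_lt ?_
    nontriviality R
    calc (P %ₘ g).degree < g.degree := degree_modByMonic_lt P hm
      _ = (g.map (algebraMap R K)).degree := (hm.degree_map _).symm
      _ = s.card := by rw [hg]; exact Lagrange.degree_nodal
  rw [← coeff_map, Lagrange.coeff_eq_sum hv hdeg]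
  refine Finset.sum_congr rfl fun i hi => ?_
  have hroot : aeval (v i) g = 0 := (aeval_eq_zero_iff_of_map_eq_prod hg _).2 ⟨i, hi, rfl⟩
  rw [aeval_derivative_of_map_eq_prod hg hi, eval_map_algebraMap,
    ← aeval_modByMonic_eq_self_of_root hroot]

theorem prod_aeval_derivative {m : ℕ} [Algebra R ℂ] {b : Fin m → ℂ}
    (hg : g.map (algebraMap R ℂ) = ∏ i, (X - C (b i))) :
    ∏ i, aeval (b i) (derivative g) =
      (-1) ^ (∑ i : Fin m, (Finset.Ioi i).card) * discriminant b := by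
  calc ∏ i, aeval (b i) (derivative g)
      = ∏ i, ∏ j ∈ {i}ᶜ, (b i - b j) := by
        simp only [aeval_derivative_of_map_eq_prod hg (Finset.mem_univ _), Finset.compl_singleton]
    _ = ∏ i, ∏ j ∈ Finset.Ioi i, (-1) * (b i - b j) ^ 2 := by
        rw [← Finset.prod_prod_Ioi_mul_eq_prod_prod_off_diag fun i j => b j - b i]
        exact Finset.prod_congr rfl fun i _ => Finset.prod_congr rfl fun j _ => by ring
    _ = _ := by
        simp only [Finset.prod_mul_distrib, Finset.prod_const, Finset.prod_pow_eq_pow_sum,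
          discriminant]

theorem exists_dvd_mul_X_sub_one (hg : IsUnit (g.coeff 0)) : ∃ q : R[X], g ∣ q * X - 1 := by
  obtain ⟨a, ha⟩ := hg.exists_left_inv
  refine ⟨-(C a * g.divX), C (-a), ?_⟩
  have h : C a * (g.divX * X + C (g.coeff 0)) = C a * g := by rw [divX_mul_X_add]
  rw [mul_add, ← C_mul, ha, C_1] at h
  rw [C_neg]
  linear_combination -h

end Roots

section Conjugates

variable {β : ℝ}

theorem aeval_ofReal (x : ℝ) (p : ℤ[X]) : aeval (x : ℂ) p = ((aeval x p : ℝ) : ℂ) :=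
  aeval_algebraMap_apply ℂ x p

theorem aeval_charPol_ofReal (β : ℝ) : aeval (β : ℂ) (charPol β) = 0 := by
  rw [aeval_ofReal, minpoly.aeval, Complex.ofReal_zero]

theorem separable_map_charPol (hβ : IsIntegral ℤ β) :
    ((charPol β).map (algebraMap ℤ ℂ)).Separable := by
  have h : (minpoly ℚ β).Separable := (minpoly.irreducible hβ.tower_top).separable
  rw [minpoly.isIntegrallyClosed_eq_field_fractions' ℚ hβ] at h
  rw [IsScalarTower.algebraMap_eq ℤ ℚ ℂ, ← Polynomial.map_map]
  exact h.map

/-- The conjugates `β₁, …, βₘ` of `β`, as a set. -/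
def conjugates (β : ℝ) : Finset ℂ := ((charPol β).aroots ℂ).toFinset

theorem mem_conjugates (hβ : IsIntegral ℤ β) {z : ℂ} :
    z ∈ conjugates β ↔ aeval z (charPol β) = 0 := by
  rw [conjugates, Multiset.mem_toFinset, mem_aroots, and_iff_right (minpoly.ne_zero hβ)]

theorem ofReal_mem_conjugates (hβ : IsIntegral ℤ β) : (β : ℂ) ∈ conjugates β :=
  (mem_conjugates hβ).2 (aeval_charPol_ofReal β)

theorem map_charPol (hβ : IsIntegral ℤ β) :
    (charPol β).map (algebraMap ℤ ℂ) = ∏ z ∈ conjugates β, (X - C z) := by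
  rw [(IsAlgClosed.splits _).eq_prod_roots_of_monic ((minpoly.monic hβ).map _), conjugates,
    Finset.prod_eq_multiset_prod, Multiset.toFinset_val, aroots,
    (nodup_roots (separable_map_charPol hβ)).dedup]

theorem xi₀_ne_zero (hβ : IsIntegral ℤ β) : xi₀ β ≠ 0 := by
  have h := (separable_map_charPol hβ).aeval_derivative_ne_zero (x := (β : ℂ))
    (by rw [aeval_map_algebraMap, aeval_charPol_ofReal])
  rw [derivative_map, aeval_map_algebraMap, aeval_ofReal] at h
  exact inv_ne_zero fun h0 => h (by rw [h0, Complex.ofReal_zero])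

end Conjugates

section Companion

open Matrix

variable {R S n : Type*} [CommRing R] [CommRing S] [Algebra R S] [Fintype n]

theorem eq_zero_of_map_mulVec_eq_zero {l : Type*} {N : Matrix l n R} {v : n → S}
    (hv : LinearIndependent R v) (h : N.map (algebraMap R S) *ᵥ v = 0) : N = 0 := by
  ext i j
  refine Fintype.linearIndependent_iff.1 hv (N i) ?_ j
  simp only [Algebra.smul_def]
  exact congrFun h i

variable [DecidableEq n]

theorem map_aeval_mulVec {A : Matrix n n R} {v : n → S} {z : S}
    (h : A.map (algebraMap R S) *ᵥ v = z • v) (p : R[X]) :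
    (aeval A p).map (algebraMap R S) *ᵥ v = aeval z p • v := by
  have hmap : (aeval A p).map (algebraMap R S) = aeval (A.map (algebraMap R S)) p :=
    (aeval_algHom_apply (Algebra.ofId R S).mapMatrix A p).symm
  rw [hmap]
  have hpow (k : ℕ) : (A.map (algebraMap R S)) ^ k *ᵥ v = z ^ k • v := by
    induction k with
    | zero => rw [pow_zero, pow_zero, one_mulVec, one_smul]
    | succ k ih => rw [pow_succ', ← mulVec_mulVec, ih, mulVec_smul, h, smul_smul, pow_succ]
  simp only [aeval_eq_sum_range, sum_mulVec, smul_mulVec, hpow, Finset.sum_smul, smul_assoc]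

theorem det_eq_prod_of_mul_eq_mul_diagonal {A E : Matrix n n R} {d : n → R} (hE : IsUnit E.det)
    (h : A * E = E * diagonal d) : A.det = ∏ i, d i := by
  have hdet := congrArg det h
  rw [det_mul, det_mul, det_diagonal, mul_comm] at hdet
  exact hE.mul_left_cancel hdet

/-- The vector `(z ^ (m - 1), …, z, 1)`, an eigenvector of the companion matrix if `z` is a root. -/
def revPowers {M : Type*} [Monoid M] (m : ℕ) (z : M) : Fin m → M := fun i => z ^ (i.rev : ℕ)

variable {β : ℝ}

theorem map_companion_mulVec_revPowers (hβ : IsIntegral ℤ β) {z : S}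
    (hz : aeval z (charPol β) = 0) :
    (companion β).map (algebraMap ℤ S) *ᵥ revPowers (deg β) z = z • revPowers (deg β) z := by
  ext i
  rw [Pi.smul_apply, smul_eq_mul, revPowers, ← pow_succ', mulVec, dotProduct, Fin.val_rev]
  rcases Nat.eq_zero_or_pos (i : ℕ) with hi | hi
  · have hroot : z ^ deg β = -∑ k : Fin (deg β), (charPol β).coeff k • z ^ (k : ℕ) := by
      rw [aeval_eq_sum_range, Finset.sum_range_succ, (minpoly.monic hβ).coeff_natDegree, one_smul,
        Finset.sum_range] at hz
      exact eq_neg_of_add_eq_zero_right hz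
    rw [show deg β - (i + 1) + 1 = deg β by omega, hroot, ← Equiv.sum_comp Fin.revPerm,
      ← Finset.sum_neg_distrib]
    refine Finset.sum_congr rfl fun j _ => ?_
    have hj : deg β - 1 - (deg β - (j + 1)) = j := by omega
    simp [companion, hi, revPowers, Fin.val_rev, hj]
  · rw [Finset.sum_eq_single ⟨i - 1, by omega⟩]
    · rw [show deg β - (i + 1) + 1 = deg β - i by omega]
      simp [companion, hi.ne', revPowers, Fin.val_rev, Nat.sub_add_cancel hi]
    · intro j _ hj
      have : (i : ℕ) ≠ j + 1 := fun h => hj (Fin.ext (by simp [h]))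
      simp [companion, hi.ne', this]
    · simp

theorem linearIndependent_revPowers (hβ : IsIntegral ℤ β) :
    LinearIndependent ℤ (revPowers (deg β) β) := by
  have h : LinearIndependent ℚ fun i : Fin (minpoly ℚ β).natDegree => β ^ (i : ℕ) :=
    linearIndependent_pow β
  rw [minpoly.isIntegrallyClosed_eq_field_fractions' ℚ hβ, (minpoly.monic hβ).natDegree_map] at h
  exact (h.restrict_scalars' ℤ).comp _ Fin.rev_injective

theorem aeval_companion_eq_zero (hβ : IsIntegral ℤ β) {p : ℤ[X]} (hp : aeval β p = 0) :
    aeval (companion β) p = 0 := by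
  refine eq_zero_of_map_mulVec_eq_zero (linearIndependent_revPowers hβ) ?_
  rw [map_aeval_mulVec (map_companion_mulVec_revPowers hβ (minpoly.aeval ℤ β)), hp, zero_smul]

theorem aeval_companion_congr (hβ : IsIntegral ℤ β) {p q : ℤ[X]} (h : aeval β p = aeval β q) :
    aeval (companion β) p = aeval (companion β) q := by
  rw [← sub_eq_zero, ← map_sub]
  exact aeval_companion_eq_zero hβ (by rw [map_sub, h, sub_self])

theorem det_aeval_companion (hβ : IsIntegral ℤ β) {b : Fin (deg β) → ℂ}
    (hb : (charPol β).map (algebraMap ℤ ℂ) = ∏ i, (X - C (b i))) (p : ℤ[X]) :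
    ((aeval (companion β) p).det : ℂ) = ∏ i, aeval (b i) p := by
  have hinj : Function.Injective b := by
    rw [← separable_prod_X_sub_C_iff, ← hb]
    exact separable_map_charPol hβ
  set E : Matrix (Fin (deg β)) (Fin (deg β)) ℂ := (projVandermonde 1 b)ᵀ with hE
  have hEunit : IsUnit E.det := by
    rw [hE, det_transpose, det_projVandermonde, isUnit_iff_ne_zero]
    simp only [Finset.prod_ne_zero_iff, Finset.mem_Ioi, Pi.one_apply, one_mul]
    exact fun i _ j hij => sub_ne_zero.2 (hinj.ne hij.ne)
  have hcol (i : Fin (deg β)) : E.col i = revPowers (deg β) (b i) := by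
    ext j
    simp [E, revPowers, projVandermonde_apply]
  rw [Int.cast_det]
  refine det_eq_prod_of_mul_eq_mul_diagonal hEunit ?_
  ext j i
  have hroot : aeval (b i) (charPol β) = 0 :=
    (aeval_eq_zero_iff_of_map_eq_prod hb _).2 ⟨i, Finset.mem_univ i, rfl⟩
  have heig := congrFun (map_aeval_mulVec (map_companion_mulVec_revPowers hβ hroot) p) j
  rw [← hcol] at heig
  rw [mul_diagonal, mul_comm]
  exact heig

theorem exists_aeval_eq_zpow (hβ : IsPisotUnit β) (k : ℤ) : ∃ P : ℤ[X],
    aeval (companion β) P = companion β ^ k ∧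
      ∀ z : ℂ, aeval z (charPol β) = 0 → aeval z P = z ^ k := by
  obtain ⟨q, hq⟩ := exists_dvd_mul_X_sub_one (Int.isUnit_iff.2 hβ.coeff_zero)
  have hmul {A : Type} [Ring A] {x : A} (hx : aeval x (charPol β) = 0) : aeval x q * x = 1 := by
    obtain ⟨r, hr⟩ := hq
    have := congrArg (aeval x) hr
    rwa [map_mul, hx, zero_mul, map_sub, map_mul, aeval_X, map_one, sub_eq_zero] at this
  have hcomp := hmul (aeval_companion_eq_zero hβ.isIntegral (minpoly.aeval ℤ β))
  obtain ⟨n, rfl | rfl⟩ := Int.eq_nat_or_neg k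
  · exact ⟨X ^ n, by simp⟩
  · refine ⟨q ^ n, ?_, fun z hz => ?_⟩
    · rw [map_pow, zpow_neg_natCast, ← inv_pow', inv_eq_left_inv hcomp]
      rfl
    · rw [map_pow, _root_.zpow_neg, zpow_natCast, ← inv_pow, eq_inv_of_mul_eq_one_left (hmul hz)]

end Companion

section Trace

variable {β : ℝ}

/-- The trace of `β ^ j / g'(β)`, an integer by Euler's formula if `β` is a unit. -/
def dualTrace (β : ℝ) (j : ℤ) : ℤ :=
  ⌊(∑ z ∈ conjugates β, z ^ j / aeval z (derivative (charPol β))).re⌋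

/-- The difference between `ξ₀ β ^ j` and its approximation by the integer `dualTrace β j`. -/
def traceError (β : ℝ) (j : ℤ) : ℝ := xi₀ β * β ^ j - dualTrace β j

theorem coe_dualTrace (hβ : IsPisotUnit β) (j : ℤ) :
    (dualTrace β j : ℂ) = ∑ z ∈ conjugates β, z ^ j / aeval z (derivative (charPol β)) := by
  obtain ⟨P, -, hP⟩ := exists_aeval_eq_zpow hβ j
  have hint : ∑ z ∈ conjugates β, z ^ j / aeval z (derivative (charPol β)) =
      algebraMap ℤ ℂ ((P %ₘ charPol β).coeff ((conjugates β).card - 1)) := by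
    rw [← sum_aeval_div_aeval_derivative (minpoly.monic hβ.isIntegral) (map_charPol hβ.isIntegral)
      Function.injective_id.injOn P]
    exact Finset.sum_congr rfl fun z hz => by
      rw [hP z ((mem_conjugates hβ.isIntegral).1 hz)]
  rw [dualTrace, hint, eq_intCast, Complex.intCast_re, Int.floor_intCast]

theorem ofReal_traceError (hβ : IsPisotUnit β) (j : ℤ) :
    (traceError β j : ℂ) =
      -∑ z ∈ (conjugates β).erase β, z ^ j / aeval z (derivative (charPol β)) := by
  have h := coe_dualTrace hβ j
  rw [← Finset.add_sum_erase _ _ (ofReal_mem_conjugates hβ.isIntegral), aeval_ofReal] at h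
  push_cast [traceError, xi₀, h]
  ring

theorem summable_traceError (hβ : IsPisotUnit β) : Summable fun n : ℕ => traceError β n := by
  rw [← Complex.summable_ofReal]
  simp only [ofReal_traceError hβ, zpow_natCast]
  refine (summable_sum fun z hz => ?_).neg
  obtain ⟨hne, hz⟩ := Finset.mem_erase.1 hz
  exact (summable_geometric_of_norm_lt_one
    (hβ.norm_conj_lt z ((mem_conjugates hβ.isIntegral).1 hz) hne)).div_const _

/-- The linear functional on `ℝ ^ m` whose kernel is the hyperplane contracted by the companion
matrix. Its coefficients are those of `g / (X - β)`. -/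
def expandingFunctional (β : ℝ) : (Fin (deg β) → ℝ) →ₗ[ℝ] ℝ :=
  Fintype.linearCombination ℝ fun i => (minpolyDiv ℤ β).coeff i.rev

theorem expandingFunctional_ne_zero (hβ : IsIntegral ℤ β) : expandingFunctional β ≠ 0 := by
  intro h
  have hpos : 0 < deg β := minpoly.natDegree_pos hβ
  have h0 := LinearMap.congr_fun h (Pi.single ⟨0, hpos⟩ 1)
  have hlead : deg β - 1 = (minpolyDiv ℤ β).natDegree :=
    (Nat.eq_sub_of_add_eq (natDegree_minpolyDiv_succ hβ)).symm
  simp [expandingFunctional, Fintype.linearCombination_apply_single, Fin.val_rev, hlead,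
    (minpolyDiv_monic hβ).leadingCoeff] at h0

theorem ne_zero_of_mem_conjugates (hβ : IsPisotUnit β) {z : ℂ} (hz : z ∈ conjugates β) :
    z ≠ 0 := by
  rintro rfl
  have h := (mem_conjugates hβ.isIntegral).1 hz
  rw [← coeff_zero_eq_aeval_zero', map_eq_zero_iff _ (algebraMap ℤ ℂ).injective_int] at h
  exact (Int.isUnit_iff.2 hβ.coeff_zero).ne_zero h

theorem aeval_minpolyDiv_eq_zero {z : ℂ} (hz : aeval z (charPol β) = 0) (hne : z ≠ β) :
    aeval z (minpolyDiv ℤ β) = 0 := by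
  classical
  rw [aeval_def, eval₂_minpolyDiv_of_eval₂_eq_zero _ (by exact hz)]
  exact if_neg hne.symm

theorem expandingFunctional_conjugate (hβ : IsPisotUnit β) {z : ℂ}
    (hz : z ∈ (conjugates β).erase β) (j : ℤ) :
    ∑ i : Fin (deg β), z ^ (j - (i : ℕ)) * (minpolyDiv ℤ β).coeff i.rev = 0 := by
  obtain ⟨hne, hz⟩ := Finset.mem_erase.1 hz
  have hroot := aeval_minpolyDiv_eq_zero ((mem_conjugates hβ.isIntegral).1 hz) hne
  rw [aeval_eq_sum_range, natDegree_minpolyDiv_succ hβ.isIntegral, Finset.sum_range,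
    ← Equiv.sum_comp Fin.revPerm] at hroot
  calc ∑ i : Fin (deg β), z ^ (j - (i : ℕ)) * (minpolyDiv ℤ β).coeff i.rev
      = z ^ (j - deg β + 1) * ∑ i : Fin (deg β),
          (minpolyDiv ℤ β).coeff i.rev • z ^ (i.rev : ℕ) := by
        rw [Finset.mul_sum]
        refine Finset.sum_congr rfl fun i _ => ?_
        have hexp : j - (i : ℕ) = j - deg β + 1 + (i.rev : ℕ) := by
          rw [Fin.val_rev]
          omega
        rw [hexp, zpow_add₀ (ne_zero_of_mem_conjugates hβ hz), zpow_natCast, Complex.real_smul]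
        ring
    _ = 0 := mul_eq_zero_of_right _ hroot

theorem expandingFunctional_traceError (hβ : IsPisotUnit β) (j : ℤ) :
    expandingFunctional β (fun i => traceError β (j - (i : ℕ))) = 0 := by
  rw [expandingFunctional, Fintype.linearCombination_apply, ← Complex.ofReal_inj]
  push_cast [smul_eq_mul, ofReal_traceError hβ]
  simp only [neg_mul, Finset.sum_mul, Finset.sum_neg_distrib, div_mul_eq_mul_div]
  rw [Finset.sum_comm, neg_eq_zero]
  refine Finset.sum_eq_zero fun z hz => ?_
  rw [← Finset.sum_div, expandingFunctional_conjugate hβ hz, zero_div]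

end Trace

section Expansions

open Filter Topology

variable {β x : ℝ} {d e : ℕ → ℕ} {r R : ℕ → ℝ}

/-- `r n` is the value `∑ j, d (n + j) β ^ (-j - 1)` of the `n`-th tail of the `β`-expansion `d`,
and all these values lie in `[0, 1]`. They are encoded by the recursion they satisfy. -/
structure IsRemainderSeq (β : ℝ) (d : ℕ → ℕ) (r : ℕ → ℝ) : Prop where
  nonneg : ∀ n, 0 ≤ r n
  le_one : ∀ n, r n ≤ 1
  succ : ∀ n, r (n + 1) = β * r n - d n

theorem IsRemainderSeq.tail (h : IsRemainderSeq β d r) (n : ℕ) :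
    IsRemainderSeq β (fun j => d (n + j)) (fun j => r (n + j)) :=
  ⟨fun _ => h.nonneg _, fun _ => h.le_one _, fun j => h.succ (n + j)⟩

theorem IsRemainderSeq.sum_range (h : IsRemainderSeq β d r) (hβ : β ≠ 0) (n : ℕ) :
    ∑ i ∈ Finset.range n, d i * β⁻¹ ^ (i + 1) = r 0 - r n * β⁻¹ ^ n := by
  induction n with
  | zero => simp
  | succ n ih =>
    rw [Finset.sum_range_succ, ih, h.succ, pow_succ]
    field_simp
    ring

theorem IsRemainderSeq.hasSum (h : IsRemainderSeq β d r) (hβ : 1 < β) :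
    HasSum (fun n => d n * β⁻¹ ^ (n + 1)) (r 0) := by
  have hβ0 : 0 < β := zero_lt_one.trans hβ
  have hrem : Tendsto (fun n => r n * β⁻¹ ^ n) atTop (𝓝 0) :=
    squeeze_zero (fun n => mul_nonneg (h.nonneg n) (by positivity))
      (fun n => mul_le_of_le_one_left (by positivity) (h.le_one n))
      (tendsto_pow_atTop_nhds_zero_of_lt_one (by positivity) (inv_lt_one_of_one_lt₀ hβ))
  rw [hasSum_iff_tendsto_nat_of_nonneg fun i => by positivity]
  simpa only [h.sum_range hβ0.ne', sub_zero] using hrem.const_sub (r 0)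

theorem IsRemainderSeq.lexLT (hβ : 1 < β) (hd : IsRemainderSeq β d r) (he : IsRemainderSeq β e R)
    (hlt : r 0 < R 0) : LexLT d e := by
  classical
  have hβ0 : 0 < β := zero_lt_one.trans hβ
  have hne : ∃ n, d n ≠ e n := by
    by_contra! heq
    obtain rfl : d = e := funext heq
    exact hlt.ne ((hd.hasSum hβ).unique (he.hasSum hβ))
  set n := Nat.find hne
  have heq : ∀ i < n, d i = e i := fun i hi => not_not.1 (Nat.find_min hne hi)
  have hrem : r n < R n := by
    have hsum : r 0 - r n * β⁻¹ ^ n = R 0 - R n * β⁻¹ ^ n := by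
      rw [← hd.sum_range hβ0.ne', ← he.sum_range hβ0.ne']
      exact Finset.sum_congr rfl fun i hi => by rw [heq i (Finset.mem_range.1 hi)]
    exact lt_of_mul_lt_mul_right (by linarith) (by positivity : 0 ≤ β⁻¹ ^ n)
  have hdigit : (d n : ℝ) < e n + 1 := by
    have := mul_lt_mul_of_pos_left hrem hβ0
    linarith [hd.nonneg (n + 1), he.le_one (n + 1), hd.succ n, he.succ n]
  exact ⟨n, heq, lt_of_le_of_ne (Nat.lt_succ_iff.1 (mod_cast hdigit)) (Nat.find_spec hne)⟩

theorem IsRemainderSeq.periodize (h : IsRemainderSeq β d r) (h0 : r 0 = 1) {k : ℕ} (hk : 0 < k)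
    (hrk : r k = 0) (hdk : d (k - 1) ≠ 0) :
    IsRemainderSeq β (fun n => if n % k + 1 = k then d (n % k) - 1 else d (n % k))
      (fun n => r (n % k)) := by
  refine ⟨fun _ => h.nonneg _, fun _ => h.le_one _, fun n => ?_⟩
  have hlt : n % k < k := Nat.mod_lt n hk
  have hsucc := h.succ (n % k)
  split_ifs with hn
  · have hdig : 1 ≤ d (n % k) := by
      rw [Nat.eq_sub_of_add_eq hn]
      exact Nat.one_le_iff_ne_zero.2 hdk
    rw [hn, hrk] at hsucc
    rw [← Nat.mod_add_mod, hn, Nat.mod_self, h0, Nat.cast_sub hdig]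
    push_cast
    linarith
  · rw [← Nat.mod_add_mod, Nat.mod_eq_of_lt (by omega), hsucc]

/-- The remainders of the greedy algorithm in base `β` started at `x`. -/
def greedyRem (β x : ℝ) (n : ℕ) : ℝ := (fun y : ℝ => Int.fract (β * y))^[n] x

theorem greedyRem_succ (n : ℕ) : greedyRem β x (n + 1) = Int.fract (β * greedyRem β x n) :=
  Function.iterate_succ_apply' ..

theorem greedyRem_lt_one (hx : x < 1) : ∀ n, greedyRem β x n < 1
  | 0 => hx
  | n + 1 => greedyRem_succ (x := x) n ▸ Int.fract_lt_one _

theorem isRemainderSeq_greedy (hβ : 0 ≤ β) (hx : x ∈ Set.Icc 0 1) :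
    IsRemainderSeq β (greedyDigit β x) (greedyRem β x) := by
  have hnonneg : ∀ n, 0 ≤ greedyRem β x n
    | 0 => hx.1
    | n + 1 => greedyRem_succ (x := x) n ▸ Int.fract_nonneg _
  refine ⟨hnonneg, fun n => ?_, fun n => ?_⟩
  · cases n with
    | zero => exact hx.2
    | succ n => exact greedyRem_succ (x := x) n ▸ (Int.fract_lt_one _).le
  · rw [greedyRem_succ, Int.fract, ← natCast_floor_eq_intCast_floor (mul_nonneg hβ (hnonneg n))]
    rfl

theorem exists_isRemainderSeq_quasiGreedyOne (hβ : 1 < β) :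
    ∃ R : ℕ → ℝ, R 0 = 1 ∧ IsRemainderSeq β (quasiGreedyOne β) R := by
  classical
  have hgreedy : IsRemainderSeq β (greedyDigit β 1) (greedyRem β 1) :=
    isRemainderSeq_greedy (zero_le_one.trans hβ.le) (Set.right_mem_Icc.2 zero_le_one)
  by_cases h : EndsInZeros (greedyDigit β 1)
  · have hrem : greedyRem β 1 (Nat.find h) = 0 := by
      refine ((hgreedy.tail (Nat.find h)).hasSum hβ).unique ?_
      simp [Nat.find_spec h]
    have hpos : 0 < Nat.find h := Nat.pos_of_ne_zero fun h0 => by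
      rw [h0] at hrem
      exact one_ne_zero hrem
    have hlast : greedyDigit β 1 (Nat.find h - 1) ≠ 0 := fun h0 => by
      refine Nat.find_min h (Nat.sub_one_lt hpos.ne') fun n hn => ?_
      obtain rfl | hlt := hn.eq_or_lt
      · exact h0
      · exact Nat.find_spec h n (by omega)
    refine ⟨fun n => greedyRem β 1 (n % Nat.find h), congrArg _ (Nat.zero_mod _), ?_⟩
    rw [quasiGreedyOne, dif_pos h]
    exact hgreedy.periodize rfl hpos hrem hlast
  · refine ⟨greedyRem β 1, rfl, ?_⟩
    rwa [quasiGreedyOne, dif_neg h]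

theorem quasiGreedyOne_zero_pos (hβ : 1 < β) : 0 < quasiGreedyOne β 0 := by
  obtain ⟨R, hR0, hR⟩ := exists_isRemainderSeq_quasiGreedyOne hβ
  have hpos : (0 : ℝ) < quasiGreedyOne β 0 := by
    have := hR.succ 0
    rw [hR0] at this
    linarith [hR.le_one (0 + 1)]
  exact_mod_cast hpos

theorem greedyDigit_tail_lexLT (hβ : 1 < β) (hx : x ∈ Set.Ico 0 1) (n : ℕ) :
    LexLT (fun j => greedyDigit β x (n + j)) (quasiGreedyOne β) := by
  obtain ⟨R, hR0, hR⟩ := exists_isRemainderSeq_quasiGreedyOne hβ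
  refine ((isRemainderSeq_greedy (zero_le_one.trans hβ.le) ⟨hx.1, hx.2.le⟩).tail n).lexLT hβ hR ?_
  rw [hR0]
  exact greedyRem_lt_one hx.2 _

end Expansions

section Compactum

open Filter Topology

variable {β : ℝ} {d : ℕ → ℕ}

theorem lexLT_iff_toLex_lt {x y : ℕ → ℕ} : LexLT x y ↔ toLex x < toLex y := Iff.rfl

theorem isOpen_setOf_lexLT (d : ℕ → ℕ) : IsOpen {x | LexLT d x} := by
  rw [isOpen_iff_mem_nhds]
  rintro x ⟨n, heq, hlt⟩
  have hev : ∀ᶠ y in 𝓝 x, ∀ i ∈ Finset.range (n + 1), y i = x i :=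
    (Finset.range (n + 1)).eventually_all.2 fun i _ =>
      (continuous_apply i).continuousAt.eventually ((isOpen_discrete {x i}).mem_nhds rfl)
  filter_upwards [hev] with y hy
  simp only [Finset.mem_range, Nat.lt_succ_iff] at hy
  exact ⟨n, fun i hi => (heq i hi).trans (hy i hi.le).symm, hlt.trans_eq (hy n le_rfl).symm⟩

theorem digit_le_of_mem_compactum {ε : ℤ → ℕ} (hε : ε ∈ compactum β) (k : ℤ) :
    ε k ≤ quasiGreedyOne β 0 := by
  obtain ⟨n, heq, hlt⟩ := hε k
  rcases n.eq_zero_or_pos with rfl | hn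
  · simpa only [Nat.cast_zero, add_zero] using hlt.le
  · simpa only [Nat.cast_zero, add_zero] using (heq 0 hn).le

theorem exists_tail_eq_of_mem_closure_compactum {ε : ℤ → ℕ} (hε : ε ∈ closure (compactum β))
    (hne : ε ∉ compactum β) : ∃ n : ℤ, ∀ j : ℕ, ε (n + j) = quasiGreedyOne β j := by
  obtain ⟨n, hn⟩ := not_forall.1 hne
  refine ⟨n, fun j => ?_⟩
  let tail (η : ℤ → ℕ) (j : ℕ) : ℕ := η (n + j)
  by_contra hj
  have hgt : LexLT (quasiGreedyOne β) (tail ε) :=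
    lt_of_le_of_ne (not_lt.1 (mt lexLT_iff_toLex_lt.2 hn)) fun h => hj (congrFun h j).symm
  have htail : Continuous tail := continuous_pi fun j => continuous_apply (n + (j : ℤ))
  obtain ⟨η, hη, hη'⟩ :=
    mem_closure_iff.1 hε _ ((isOpen_setOf_lexLT (quasiGreedyOne β)).preimage htail) hgt
  exact lt_asymm (lexLT_iff_toLex_lt.1 hη) (hη' n)

theorem extend_mem_compactum (hβ : 1 < β)
    (hd : ∀ n, LexLT (fun j => d (n + j)) (quasiGreedyOne β)) (a : ℤ) :
    Function.extend (fun n : ℕ => n + a) d 0 ∈ compactum β := by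
  have hinj : Function.Injective fun n : ℕ => n + a :=
    (add_left_injective a).comp Nat.cast_injective
  intro n
  rcases le_or_gt a n with han | hna
  · obtain ⟨N, rfl⟩ : ∃ N : ℕ, n = N + a := ⟨(n - a).toNat, by omega⟩
    convert hd N using 2 with j
    rw [← hinj.extend_apply d 0 (N + j)]
    congr 1
    push_cast
    ring
  · have hrange : ¬∃ N : ℕ, N + a = n + (0 : ℕ) := by
      rintro ⟨N, hN⟩
      omega
    exact ⟨0, fun i hi => absurd hi i.not_lt_zero,
      (Function.extend_apply' d (0 : ℤ → ℕ) _ hrange).trans_lt (quasiGreedyOne_zero_pos hβ)⟩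

theorem exists_mem_compactum_hasSum (hβ : 1 < β) {s : ℝ} (hs : 0 ≤ s) :
    ∃ ε ∈ compactum β, HasSum (fun k : ℤ => ε k * β ^ (-k)) s := by
  have hβ0 : 0 < β := zero_lt_one.trans hβ
  obtain ⟨K, hK⟩ := pow_unbounded_of_one_lt s hβ
  have hx : s / β ^ K ∈ Set.Ico 0 1 := ⟨by positivity, (div_lt_one (by positivity)).2 hK⟩
  refine ⟨_, extend_mem_compactum hβ (greedyDigit_tail_lexLT hβ hx) (1 - K), ?_⟩
  have hinj : Function.Injective fun n : ℕ => n + (1 - K : ℤ) :=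
    (add_left_injective _).comp Nat.cast_injective
  rw [← hinj.hasSum_iff fun k hk => by
    rw [Function.extend_apply' _ _ _ hk, Pi.zero_apply, Nat.cast_zero, zero_mul]]
  have hsum := ((isRemainderSeq_greedy hβ0.le ⟨hx.1, hx.2.le⟩).hasSum hβ).mul_left (β ^ K)
  rw [show greedyRem β (s / β ^ K) 0 = s / β ^ K from rfl,
    mul_div_cancel₀ _ (by positivity)] at hsum
  refine hsum.congr_fun fun n => ?_
  rw [Function.comp_apply, hinj.extend_apply, show -(n + (1 - K : ℤ)) = K - (n + 1 : ℕ) by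
    push_cast; ring, zpow_sub₀ hβ0.ne', zpow_natCast, zpow_natCast, inv_pow]
  ring

end Compactum

section Torus

variable {ι : Type*}

/-- The projection `ℝ ^ ι → ℝ ^ ι / ℤ ^ ι`. -/
def proj : (ι → ℝ) →+ UnitAddTorus ι := (QuotientAddGroup.mk' _).compLeft ι

theorem proj_apply (x : ι → ℝ) (i : ι) : proj x i = (x i : UnitAddCircle) := rfl

theorem continuous_proj : Continuous (proj (ι := ι)) :=
  continuous_pi fun i => (AddCircle.continuous_mk' 1).comp (continuous_apply i)

theorem surjective_proj : Function.Surjective (proj (ι := ι)) :=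
  (QuotientAddGroup.mk_surjective (s := AddSubgroup.zmultiples (1 : ℝ))).comp_left

theorem proj_eq_proj_iff {x y : ι → ℝ} :
    proj x = proj y ↔ ∃ z : ι → ℤ, x = y + fun i => (z i : ℝ) := by
  have hcoord (i : ι) : proj x i = proj y i ↔ ∃ n : ℤ, x i = y i + n := by
    rw [proj_apply, proj_apply, ← sub_eq_zero, ← AddCircle.coe_sub, AddCircle.coe_eq_zero_iff]
    simp only [zsmul_one, eq_comm (b := x i - y i), sub_eq_iff_eq_add']
  simp only [funext_iff, hcoord, Classical.skolem, Pi.add_apply]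

variable [Fintype ι]

theorem norm_proj_le (x : ι → ℝ) : ‖proj x‖ ≤ ‖x‖ :=
  (pi_norm_le_iff_of_nonneg (norm_nonneg _)).2 fun i =>
    QuotientAddGroup.norm_mk_le_norm.trans (norm_le_pi_norm x i)

theorem volume_image_proj_eq_zero {S : Set (ι → ℝ)} (hS : volume S = 0) :
    volume (proj '' S) = 0 := by
  have hsection : MeasurePreserving
      (fun (y : UnitAddTorus ι) i => (AddCircle.equivIoc 1 0 (y i) : ℝ)) volume
      (Measure.pi fun _ => volume.restrict (Set.Ioc 0 (0 + 1))) :=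
    measurePreserving_pi _ _ fun _ =>
      (measurePreserving_subtype_coe measurableSet_Ioc).comp
        (AddCircle.measurePreserving_equivIoc 1)
  have htranslates : volume (⋃ z : ι → ℤ, (· + fun i => (z i : ℝ)) ⁻¹' S) = 0 :=
    measure_iUnion_null fun z => by rw [measure_preimage_add_right, hS]
  rw [← Measure.restrict_pi_pi, ← volume_pi] at hsection
  refine measure_mono_null ?_ (hsection.quasiMeasurePreserving.preimage_null
    (Measure.absolutelyContinuous_of_le Measure.restrict_le_self htranslates))
  rintro _ ⟨x, hx, rfl⟩
  have hproj : proj x = proj fun i => (AddCircle.equivIoc 1 0 (proj x i) : ℝ) :=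
    funext fun _ => AddCircle.coe_equivIoc.symm
  obtain ⟨z, hz⟩ := proj_eq_proj_iff.1 hproj
  exact Set.mem_iUnion.2 ⟨z, Set.mem_preimage.2 (Set.mem_of_eq_of_mem hz.symm hx)⟩

theorem volume_levelSet_eq_zero {L : (ι → ℝ) →ₗ[ℝ] ℝ} (hL : L ≠ 0) (c : ℝ) :
    volume {x | L x = c} = 0 := by
  obtain ⟨a, rfl⟩ := L.surjective hL c
  have hker : {x | L x = L a} = (· + -a) ⁻¹' (LinearMap.ker L : Set (ι → ℝ)) := by
    ext x
    simp [← sub_eq_add_neg, sub_eq_zero]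
  rw [hker, measure_preimage_add_right]
  exact Measure.addHaar_submodule _ _ (mt LinearMap.ker_eq_top.1 hL)

end Torus

section ToralEnd

open Matrix
variable {m : ℕ}

theorem toralEnd_apply (N : Matrix (Fin m) (Fin m) ℤ) (x : Torus m) (i : Fin m) :
    toralEnd N x i = ∑ j, N i j • x j := rfl

theorem continuous_toralEnd (N : Matrix (Fin m) (Fin m) ℤ) : Continuous (toralEnd N) :=
  continuous_pi fun i => by
    simp only [toralEnd_apply]
    fun_prop

theorem toralEnd_proj (N : Matrix (Fin m) (Fin m) ℤ) (x : Fin m → ℝ) :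
    toralEnd N (proj x) = proj (N.map (algebraMap ℤ ℝ) *ᵥ x) := by
  ext i
  rw [toralEnd_apply, proj_apply, mulVec, dotProduct, ← QuotientAddGroup.mk'_apply, map_sum]
  refine Finset.sum_congr rfl fun j _ => ?_
  rw [map_apply, eq_intCast, ← zsmul_eq_mul, map_zsmul]
  rfl

/-- Integer matrices act on the torus by a ring homomorphism. -/
def toralEndHom (m : ℕ) : Matrix (Fin m) (Fin m) ℤ →+* AddMonoid.End (Torus m) where
  toFun := toralEnd
  map_one' := by
    ext x i
    simp [toralEnd_apply, one_apply, ite_smul]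
  map_mul' N N' := by
    ext x i
    change toralEnd (N * N') x i = toralEnd N (toralEnd N' x) i
    simp only [toralEnd_apply, mul_apply, Finset.smul_sum, Finset.sum_smul, mul_smul]
    exact Finset.sum_comm
  map_zero' := by
    ext x i
    change toralEnd 0 x i = 0
    simp only [toralEnd_apply, Matrix.zero_apply, zero_smul, Finset.sum_const_zero]
  map_add' N N' := by
    ext x i
    change toralEnd (N + N') x i = toralEnd N x i + toralEnd N' x i
    simp only [toralEnd_apply, Matrix.add_apply, add_smul, Finset.sum_add_distrib]

theorem aeval_toralEnd (N : Matrix (Fin m) (Fin m) ℤ) (p : ℤ[X]) :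
    aeval (toralEnd N) p = toralEnd (aeval N p) :=
  aeval_algHom_apply (toralEndHom m).toIntAlgHom N p

theorem toralEnd_eq_zero_iff {N : Matrix (Fin m) (Fin m) ℤ} : toralEnd N = 0 ↔ N = 0 := by
  refine ⟨fun h => ?_, fun h => h ▸ map_zero (toralEndHom m)⟩
  ext i j
  by_contra hne
  have hne' : (N i j : ℝ) ≠ 0 := Int.cast_ne_zero.2 hne
  have hhalf : toralEnd N (proj (Pi.single j (2 * N i j : ℝ)⁻¹)) = proj 0 := by
    rw [h, map_zero]
    rfl
  rw [toralEnd_proj, proj_eq_proj_iff] at hhalf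
  obtain ⟨z, hz⟩ := hhalf
  have hi : (N i j : ℝ) * (2 * N i j : ℝ)⁻¹ = z i := by simpa [mulVec_single] using congrFun hz i
  have htwo : (1 : ℝ) = 2 * z i := by
    rw [← hi]
    field_simp
  norm_cast at htwo
  omega

theorem toralEnd_injective : Function.Injective (toralEnd (m := m)) :=
  (injective_iff_map_eq_zero (toralEndHom m)).2 fun _ => toralEnd_eq_zero_iff.1

end ToralEnd

section Equidistribution

open Filter Topology UnitAddTorus

variable {ι : Type*} [Fintype ι]

instance isProbabilityMeasure_volume_unitAddCircle :
    IsProbabilityMeasure (volume : Measure UnitAddCircle) := ⟨UnitAddCircle.measure_univ⟩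

instance isProbabilityMeasure_volume_unitAddTorus :
    IsProbabilityMeasure (volume : Measure (UnitAddTorus ι)) := by
  rw [volume_pi]
  infer_instance

theorem mFourier_proj (n : ι → ℤ) (x : ι → ℝ) :
    mFourier n (proj x) = Complex.exp (2 * Real.pi * Complex.I * (∑ i, n i * x i : ℝ)) := by
  simp only [mFourier, ContinuousMap.coe_mk, proj_apply, fourier_coe_apply, ← Complex.exp_sum]
  push_cast
  rw [Finset.mul_sum]
  exact congrArg _ (Finset.sum_congr rfl fun i _ => by ring)

theorem integral_mFourier_eq_zero {n : ι → ℤ} (hn : n ≠ 0) :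
    ∫ x : UnitAddTorus ι, mFourier n x = 0 := by
  classical
  obtain ⟨i, hi⟩ := Function.ne_iff.1 hn
  have hi' : (n i : ℝ) ≠ 0 := Int.cast_ne_zero.2 hi
  -- translation by this point changes the sign of the character
  let h : ι → ℝ := Pi.single i (2 * n i : ℝ)⁻¹
  have hsum : ∑ j, n j * h j = 2⁻¹ := by
    rw [Finset.sum_eq_single i (fun j _ hj => by simp [h, hj]) (by simp)]
    simp only [h, Pi.single_eq_same]
    field_simp
  refine integral_eq_zero_of_add_right_eq_neg (g := proj h) fun x => ?_
  obtain ⟨y, rfl⟩ := surjective_proj x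
  rw [← map_add, mFourier_proj, mFourier_proj, ← mul_neg_one, ← Complex.exp_pi_mul_I,
    ← Complex.exp_add]
  simp only [Pi.add_apply, mul_add, Finset.sum_add_distrib, hsum]
  push_cast
  ring_nf

theorem lipschitzWith_integral {X : Type*} [TopologicalSpace X] [CompactSpace X]
    [MeasurableSpace X] [BorelSpace X] (μ : Measure X) [IsProbabilityMeasure μ] :
    LipschitzWith 1 fun f : C(X, ℂ) => ∫ x, f x ∂μ := by
  refine LipschitzWith.of_dist_le_mul fun f g => ?_
  have hint (f : C(X, ℂ)) : Integrable f μ :=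
    f.continuous.integrable_of_hasCompactSupport (.of_compactSpace f)
  rw [dist_eq_norm, ← integral_sub (hint f) (hint g), NNReal.coe_one, one_mul]
  refine (norm_integral_le_of_norm_le_const (.of_forall fun x => ?_)).trans_eq
    (by rw [probReal_univ, mul_one])
  exact dist_eq_norm (f x) (g x) ▸ ContinuousMap.dist_apply_le_dist x

theorem tendsto_integral_of_tendsto_mFourier {α : Type*} {l : Filter α}
    {μ : α → Measure (UnitAddTorus ι)} [∀ a, IsProbabilityMeasure (μ a)]
    (h : ∀ n ≠ 0, Tendsto (fun a => ∫ x, mFourier n x ∂μ a) l (𝓝 0)) (f : C(UnitAddTorus ι, ℂ)) :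
    Tendsto (fun a => ∫ x, f x ∂μ a) l (𝓝 (∫ x, f x)) := by
  have hint (f : C(UnitAddTorus ι, ℂ)) (ν : Measure (UnitAddTorus ι)) [IsProbabilityMeasure ν] :
      Integrable f ν := f.continuous.integrable_of_hasCompactSupport (.of_compactSpace f)
  have hclosed : IsClosed
      {f : C(UnitAddTorus ι, ℂ) | Tendsto (fun a => ∫ x, f x ∂μ a) l (𝓝 (∫ x, f x))} :=
    (LipschitzWith.uniformEquicontinuous _ 1
      fun a => lipschitzWith_integral (μ a)).equicontinuous.isClosed_setOfPred_tendsto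
        (lipschitzWith_integral volume).continuous
  refine closure_minimal (fun f hf => ?_) hclosed
    (span_mFourier_closure_eq_top.ge (Submodule.mem_top (x := f)))
  induction hf using Submodule.span_induction with
  | mem f hf =>
    obtain ⟨n, rfl⟩ := hf
    rcases eq_or_ne n 0 with rfl | hn
    · simpa [mFourier_zero] using tendsto_const_nhds
    · simpa only [Set.mem_ofPred_eq, integral_mFourier_eq_zero hn] using h n hn
  | zero => simpa using tendsto_const_nhds
  | add f g _ _ hf hg =>
    simpa only [Set.mem_ofPred_eq, ContinuousMap.add_apply, integral_add (hint f _) (hint g _)]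
      using hf.add hg
  | smul c f _ hf =>
    simpa only [Set.mem_ofPred_eq, ContinuousMap.smul_apply, integral_smul] using hf.const_smul c

/-- The image of the uniform distribution on `[0, S]` under `s ↦ proj (s • v)`. -/
def rayMeasure (v : ι → ℝ) (S : ℝ) : Measure (UnitAddTorus ι) :=
  (volume.restrict (Set.Ioc (0 : ℝ) 1)).map fun s => proj ((S * s) • v)

theorem continuous_proj_ray {ι : Type*} (v : ι → ℝ) (S : ℝ) :
    Continuous fun s : ℝ => proj ((S * s) • v) :=
  continuous_proj.comp (by fun_prop)

instance isProbabilityMeasure_rayMeasure {ι : Type*} [Finite ι] (v : ι → ℝ) (S : ℝ) :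
    IsProbabilityMeasure (rayMeasure v S) := by
  have : IsProbabilityMeasure (volume.restrict (Set.Ioc (0 : ℝ) 1)) := ⟨by simp⟩
  exact Measure.isProbabilityMeasure_map (continuous_proj_ray v S).aemeasurable

theorem integral_rayMeasure {ι : Type*} [Finite ι] (v : ι → ℝ) (S : ℝ)
    (f : C(UnitAddTorus ι, ℂ)) :
    ∫ x, f x ∂rayMeasure v S = ∫ s in (0 : ℝ)..1, f (proj ((S * s) • v)) := by
  rw [rayMeasure, integral_map (continuous_proj_ray v S).aemeasurable
    f.continuous.aestronglyMeasurable, intervalIntegral.integral_of_le zero_le_one]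

theorem norm_integral_exp_le {c : ℝ} (hc : c ≠ 0) :
    ‖∫ s in (0 : ℝ)..1, Complex.exp (c * Complex.I * s)‖ ≤ 2 * ‖c‖⁻¹ := by
  have hc' : (c * Complex.I : ℂ) ≠ 0 :=
    mul_ne_zero (Complex.ofReal_ne_zero.2 hc) Complex.I_ne_zero
  rw [integral_exp_mul_complex hc', norm_div, norm_mul, Complex.norm_I, mul_one, Complex.norm_real,
    div_eq_mul_inv]
  gcongr
  refine (norm_sub_le _ _).trans_eq ?_
  simp [Complex.norm_exp_ofReal_mul_I, one_add_one_eq_two]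

theorem tendsto_integral_mFourier_rayMeasure {v : ι → ℝ} (hv : LinearIndependent ℤ v)
    {n : ι → ℤ} (hn : n ≠ 0) :
    Tendsto (fun S => ∫ x, mFourier n x ∂rayMeasure v S) atTop (𝓝 0) := by
  have hfreq : ∑ i, n i * v i ≠ 0 := fun h =>
    hn (funext (Fintype.linearIndependent_iff.1 hv n (by simpa only [zsmul_eq_mul] using h)))
  set c := 2 * Real.pi * ∑ i, n i * v i with hc
  have hc0 : c ≠ 0 := mul_ne_zero Real.two_pi_pos.ne' hfreq
  have hlim : Tendsto (fun S : ℝ => 2 * ‖S * c‖⁻¹) atTop (𝓝 0) := by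
    have hdiv := tendsto_abs_atTop_atTop.atTop_mul_const (abs_pos.2 hc0)
    simpa only [norm_mul, Real.norm_eq_abs, mul_zero, Pi.inv_apply] using
      hdiv.inv_tendsto_atTop.const_mul 2
  refine squeeze_zero_norm' ?_ hlim
  filter_upwards [eventually_gt_atTop 0] with S hS
  convert! norm_integral_exp_le (mul_ne_zero hS.ne' hc0) using 2
  rw [integral_rayMeasure]
  refine intervalIntegral.integral_congr fun s _ => ?_
  simp only [mFourier_proj, Pi.smul_apply, smul_eq_mul, mul_left_comm _ (S * s), ← Finset.mul_sum,
    hc]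
  push_cast
  ring_nf

theorem dense_proj_ray {ι : Type*} [Finite ι] {v : ι → ℝ} (hv : LinearIndependent ℤ v) :
    Dense ((fun s : ℝ => proj (s • v)) '' Set.Ici 0) := by
  have := Fintype.ofFinite ι
  set F := closure ((fun s : ℝ => proj (s • v)) '' Set.Ici 0)
  by_contra hd
  obtain ⟨x₀, hx₀⟩ : ∃ x, x ∉ F := not_forall.1 hd
  have hFne : F.Nonempty := ((Set.nonempty_Ici).image _).closure
  have hcont := Metric.continuous_infDist_pt F
  have hpos : 0 < ∫ x, Metric.infDist x F :=
    hcont.integral_pos_of_hasCompactSupport_nonneg_nonzero (.of_compactSpace _)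
      (fun x => Metric.infDist_nonneg)
      ((isClosed_closure.notMem_iff_infDist_pos hFne).1 hx₀).ne'
  let f : C(UnitAddTorus ι, ℂ) := ⟨_, Complex.continuous_ofReal.comp hcont⟩
  have hlim := tendsto_integral_of_tendsto_mFourier
    (fun n hn => tendsto_integral_mFourier_rayMeasure hv hn) f
  have hzero : ∀ᶠ S in atTop, ∫ x, f x ∂rayMeasure v S = 0 := by
    filter_upwards [eventually_ge_atTop 0] with S hS
    rw [integral_rayMeasure]
    refine (intervalIntegral.integral_congr (g := fun _ => (0 : ℂ)) fun s hs => ?_).trans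
      intervalIntegral.integral_zero
    rw [Set.uIcc_of_le zero_le_one] at hs
    have hmem : proj ((S * s) • v) ∈ F := subset_closure ⟨S * s, mul_nonneg hS hs.1, rfl⟩
    simp [f, Metric.infDist_zero_of_mem hmem]
  have hint : ∫ x, f x = (∫ x, Metric.infDist x F : ℝ) :=
    integral_complex_ofReal (f := fun x => Metric.infDist x F)
  rw [hint] at hlim
  exact hpos.ne' (Complex.ofReal_eq_zero.1
    (tendsto_nhds_unique hlim (tendsto_const_nhds.congr' (hzero.mono fun _ h => h.symm))))

end Equidistribution

section Homoclinic

variable {β : ℝ}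

/-- The vector `(1, β⁻¹, …, β ^ (-m + 1))`, whose multiples lift the points `homoclinic β ξ`. -/
def invPowers (β : ℝ) : Fin (deg β) → ℝ := fun i => β⁻¹ ^ (i : ℕ)

theorem homoclinic_eq_proj (ξ : ℝ) : homoclinic β ξ = proj (ξ • invPowers β) := rfl

theorem invPowers_eq_smul_revPowers (h0 : β ≠ 0) :
    invPowers β = (β ^ (deg β - 1))⁻¹ • revPowers (deg β) β := by
  ext i
  have hsplit : deg β - 1 = i.rev + i := by
    rw [Fin.val_rev]
    omega
  rw [Pi.smul_apply, smul_eq_mul, revPowers, invPowers, hsplit, pow_add, inv_pow, mul_inv_rev,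
    inv_mul_cancel_right₀ (pow_ne_zero _ h0)]

theorem map_companion_mulVec_invPowers (hβ : IsIntegral ℤ β) (h0 : β ≠ 0) :
    ((companion β).map (algebraMap ℤ ℝ)).mulVec (invPowers β) = β • invPowers β := by
  rw [invPowers_eq_smul_revPowers h0, Matrix.mulVec_smul,
    map_companion_mulVec_revPowers hβ (minpoly.aeval ℤ β), smul_comm]

theorem linearIndependent_smul_invPowers (hβ : IsIntegral ℤ β) (h0 : β ≠ 0) {ξ : ℝ}
    (hξ : ξ ≠ 0) : LinearIndependent ℤ (ξ • invPowers β) := by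
  have hne : ξ * (β ^ (deg β - 1))⁻¹ ≠ 0 := mul_ne_zero hξ (inv_ne_zero (pow_ne_zero _ h0))
  rw [invPowers_eq_smul_revPowers h0, smul_smul]
  exact (linearIndependent_revPowers hβ).map' (LinearMap.mulLeft ℤ _)
    (LinearMap.ker_eq_bot.2 (mul_right_injective₀ hne))

theorem toralEnd_aeval_homoclinic (hβ : IsIntegral ℤ β) (h0 : β ≠ 0) (p : ℤ[X]) (ξ : ℝ) :
    toralEnd (aeval (companion β) p) (homoclinic β ξ) = homoclinic β (aeval β p * ξ) := by
  rw [homoclinic_eq_proj, homoclinic_eq_proj, toralEnd_proj, Matrix.mulVec_smul,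
    map_aeval_mulVec (map_companion_mulVec_invPowers hβ h0), smul_smul, mul_comm]

theorem Tpow_homoclinic (hβ : IsPisotUnit β) (k : ℤ) (ξ : ℝ) :
    Tpow β k (homoclinic β ξ) = homoclinic β (β ^ k * ξ) := by
  obtain ⟨P, hP, hroot⟩ := exists_aeval_eq_zpow hβ k
  have hPβ : aeval β P = β ^ k := by
    have := hroot β (aeval_charPol_ofReal β)
    rw [aeval_ofReal] at this
    exact_mod_cast this
  rw [Tpow, ← hP, toralEnd_aeval_homoclinic hβ.isIntegral (zero_lt_one.trans hβ.one_lt).ne', hPβ]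

theorem toralEnd_codingTerm (hβ : IsPisotUnit β) (p : ℤ[X]) (ξ : ℝ) (ε : ℤ → ℕ) (k : ℤ) :
    toralEnd (aeval (companion β) p) (codingTerm β ξ ε k) = codingTerm β (aeval β p * ξ) ε k := by
  rw [codingTerm, codingTerm, map_nsmul, Tpow_homoclinic hβ, Tpow_homoclinic hβ,
    toralEnd_aeval_homoclinic hβ.isIntegral (zero_lt_one.trans hβ.one_lt).ne', mul_left_comm]

end Homoclinic

section Lifting

variable {β : ℝ} {ε : ℤ → ℕ} {D : ℕ}

/-- A lift to `ℝ ^ m` of the point `T ^ (-k) t₀`: left of the position `n` the powers of `β` are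
corrected by integers, so that the lifts are summable over `k`. -/
def homoclinicLift (β : ℝ) (n k : ℤ) : Fin (deg β) → ℝ := fun i =>
  if k < n then traceError β (-k - (i : ℕ)) else xi₀ β * β ^ (-k - (i : ℕ))

theorem proj_homoclinicLift (hβ : IsPisotUnit β) (n k : ℤ) :
    proj (homoclinicLift β n k) = Tpow β (-k) (homoclinic β (xi₀ β)) := by
  rw [Tpow_homoclinic hβ, homoclinic_eq_proj, eq_comm, proj_eq_proj_iff]
  refine ⟨fun i => if k < n then dualTrace β (-k - (i : ℕ)) else 0, funext fun i => ?_⟩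
  have hpow : (β ^ (-k) * xi₀ β) * invPowers β i = xi₀ β * β ^ (-k - (i : ℕ)) := by
    rw [zpow_sub₀ (zero_lt_one.trans hβ.one_lt).ne', zpow_natCast, invPowers, inv_pow]
    ring
  by_cases hk : k < n <;> simp [homoclinicLift, traceError, hk, hpow, -zpow_neg]

theorem expandingFunctional_homoclinicLift (hβ : IsPisotUnit β) {n k : ℤ} (hk : k < n) :
    expandingFunctional β (homoclinicLift β n k) = 0 := by
  convert! expandingFunctional_traceError hβ (-k) using 2
  exact funext fun i => if_pos hk

theorem summable_homoclinicLift (hβ : IsPisotUnit β) (n : ℤ) :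
    Summable (homoclinicLift β n) := by
  have hβ0 : β ≠ 0 := (zero_lt_one.trans hβ.one_lt).ne'
  refine Pi.summable.2 fun i => ?_
  rw [summable_int_iff_summable_nat_and_neg]
  constructor
  · have hgeom : Summable fun k : ℕ => xi₀ β * β⁻¹ ^ (i : ℕ) * β⁻¹ ^ k :=
      (summable_geometric_of_lt_one (inv_nonneg.2 (zero_le_one.trans hβ.one_lt.le))
        (inv_lt_one_of_one_lt₀ hβ.one_lt)).mul_left _
    refine hgeom.congr_atTop ?_
    filter_upwards [Filter.eventually_ge_atTop n.toNat] with k hk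
    rw [homoclinicLift, if_neg (by omega), zpow_sub₀ hβ0, zpow_neg, zpow_natCast, zpow_natCast,
      inv_pow, inv_pow]
    ring
  · rw [← summable_nat_add_iff (i : ℕ)]
    refine (summable_traceError hβ).congr_atTop ?_
    filter_upwards [Filter.eventually_gt_atTop (-n).toNat] with k hk
    rw [homoclinicLift, if_pos (by omega)]
    congr 1
    push_cast
    ring

theorem norm_nsmul_homoclinicLift_le (hε : ε ∈ Set.Iic fun _ => D) (n k : ℤ) :
    ‖ε k • homoclinicLift β n k‖ ≤ D * ‖homoclinicLift β n k‖ :=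
  (norm_nsmul_le).trans (by gcongr; exact hε k)

theorem summable_nsmul_homoclinicLift (hβ : IsPisotUnit β) (hε : ε ∈ Set.Iic fun _ => D) (n : ℤ) :
    Summable fun k => ε k • homoclinicLift β n k :=
  .of_norm_bounded ((summable_homoclinicLift hβ n).norm.mul_left (D : ℝ))
    (norm_nsmul_homoclinicLift_le hε n)

theorem hasSum_codingTerm_xi₀ (hβ : IsPisotUnit β) (hε : ε ∈ Set.Iic fun _ => D) (n : ℤ) :
    HasSum (codingTerm β (xi₀ β) ε) (proj (∑' k, ε k • homoclinicLift β n k)) := by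
  convert! (summable_nsmul_homoclinicLift hβ hε n).hasSum.map proj continuous_proj using 1
  funext k
  rw [Function.comp_apply, map_nsmul, proj_homoclinicLift hβ, codingTerm]

theorem continuousOn_phi₀ (hβ : IsPisotUnit β) (D : ℕ) :
    ContinuousOn (phi₀ β) (Set.Iic fun _ => D) := by
  refine continuousOn_tsum (fun k => ?_) ((summable_homoclinicLift hβ 0).norm.mul_left (D : ℝ))
    fun k ε hε => ?_
  · have hdigit : Continuous fun a : ℕ => a • Tpow β (-k) (homoclinic β (xi₀ β)) :=
      continuous_of_discreteTopology
    exact (hdigit.comp (continuous_apply k)).continuousOn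
  · rw [codingTerm, ← proj_homoclinicLift hβ 0, ← map_nsmul]
    exact (norm_proj_le _).trans (norm_nsmul_homoclinicLift_le hε 0 k)

theorem volume_phi₀_image_tail_eq_zero (hβ : IsPisotUnit β) (D : ℕ) (n : ℤ) (d : ℕ → ℕ) :
    volume (phi₀ β '' {ε ∈ Set.Iic fun _ => D | ∀ j : ℕ, ε (n + j) = d j}) = 0 := by
  set L := expandingFunctional β
  let c : ℝ := ∑' k, if k < n then 0 else d (k - n).toNat • L (homoclinicLift β n k)
  refine measure_mono_null ?_ (volume_image_proj_eq_zero
    (volume_levelSet_eq_zero (expandingFunctional_ne_zero hβ.isIntegral) c))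
  rintro _ ⟨ε, ⟨hεD, hεd⟩, rfl⟩
  refine ⟨∑' k, ε k • homoclinicLift β n k, ?_, (hasSum_codingTerm_xi₀ hβ hεD n).tsum_eq.symm⟩
  rw [Set.mem_ofPred_eq, (summable_nsmul_homoclinicLift hβ hεD n).map_tsum L
    L.continuous_of_finiteDimensional]
  refine tsum_congr fun k => ?_
  rw [map_nsmul]
  split_ifs with hk
  · rw [expandingFunctional_homoclinicLift hβ hk, smul_zero]
  · rw [← hεd, show n + ((k - n).toNat : ℤ) = k by omega]

end Lifting

section Surjectivity

variable {β : ℝ}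

theorem exists_mem_compactum_phi₀_eq_homoclinic (hβ : IsPisotUnit β) {s : ℝ} (hs : 0 ≤ s) :
    ∃ ε ∈ compactum β, phi₀ β ε = homoclinic β (s * xi₀ β) := by
  obtain ⟨ε, hε, hsum⟩ := exists_mem_compactum_hasSum hβ.one_lt hs
  refine ⟨ε, hε, ?_⟩
  have hlift := (hsum.mul_right (xi₀ β)).smul_const (invPowers β)
  rw [homoclinic_eq_proj, ← (hlift.map proj continuous_proj).tsum_eq]
  refine tsum_congr fun k => ?_
  rw [Function.comp_apply, codingTerm, Tpow_homoclinic hβ, homoclinic_eq_proj, ← map_nsmul,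
    mul_assoc, mul_smul (ε k : ℝ), Nat.cast_smul_eq_nsmul]

theorem dense_phi₀_image_compactum (hβ : IsPisotUnit β) : Dense (phi₀ β '' compactum β) := by
  have hind := linearIndependent_smul_invPowers hβ.isIntegral (zero_lt_one.trans hβ.one_lt).ne'
    (xi₀_ne_zero hβ.isIntegral)
  refine (dense_proj_ray hind).mono ?_
  rintro _ ⟨s, hs, rfl⟩
  obtain ⟨ε, hε, heq⟩ := exists_mem_compactum_phi₀_eq_homoclinic hβ hs
  exact ⟨ε, hε, by rw [heq, homoclinic_eq_proj, mul_smul]⟩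

theorem closure_compactum_subset_Iic :
    closure (compactum β) ⊆ Set.Iic fun _ => quasiGreedyOne β 0 :=
  closure_minimal (fun _ hε k => digit_le_of_mem_compactum hε k) isClosed_Iic

theorem phi₀_image_closure_compactum (hβ : IsPisotUnit β) :
    phi₀ β '' closure (compactum β) = Set.univ := by
  have hcompact : IsCompact (closure (compactum β)) :=
    (isCompact_Icc (a := 0)).of_isClosed_subset isClosed_closure fun ε hε =>
      ⟨fun k => Nat.zero_le (ε k), closure_compactum_subset_Iic hε⟩
  have hcont : ContinuousOn (phi₀ β) (closure (compactum β)) :=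
    (continuousOn_phi₀ hβ _).mono closure_compactum_subset_Iic
  rw [← (hcompact.image_of_continuousOn hcont).isClosed.closure_eq]
  exact ((dense_phi₀_image_compactum hβ).mono (Set.image_mono subset_closure)).closure_eq

theorem ae_mem_phi₀_image_compactum (hβ : IsPisotUnit β) :
    ∀ᵐ x ∂(volume : Measure (Torus (deg β))), x ∈ phi₀ β '' compactum β := by
  refine measure_mono_null (fun x hx => ?_) (measure_iUnion_null fun n =>
    volume_phi₀_image_tail_eq_zero hβ (quasiGreedyOne β 0) n (quasiGreedyOne β))
  obtain ⟨ε, hε, rfl⟩ : x ∈ phi₀ β '' closure (compactum β) :=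
    phi₀_image_closure_compactum hβ ▸ Set.mem_univ x
  obtain ⟨n, hn⟩ := exists_tail_eq_of_mem_closure_compactum hε fun h => hx ⟨ε, h, rfl⟩
  exact Set.mem_iUnion.2 ⟨n, ε, ⟨closure_compactum_subset_Iic hε, hn⟩, rfl⟩

end Surjectivity

section Extension

variable {β : ℝ}

/-- The matrix `g'(M)` of the continuous extension of `φ ∘ φ₀⁻¹`. -/
def extensionMatrix (β : ℝ) : Matrix (Fin (deg β)) (Fin (deg β)) ℤ :=
  aeval (companion β) (derivative (charPol β))

theorem inv_xi₀ (β : ℝ) : (xi₀ β)⁻¹ = aeval β (derivative (charPol β)) := inv_inv _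

theorem toralEnd_extensionMatrix_codingTerm (hβ : IsPisotUnit β) (ε : ℤ → ℕ) (k : ℤ) :
    toralEnd (extensionMatrix β) (codingTerm β (xi₀ β) ε k) = codingTerm β 1 ε k := by
  rw [extensionMatrix, toralEnd_codingTerm hβ, ← inv_xi₀,
    inv_mul_cancel₀ (xi₀_ne_zero hβ.isIntegral)]

theorem hasSum_codingTerm_one (hβ : IsPisotUnit β) {ε : ℤ → ℕ}
    (hε : Summable (codingTerm β (xi₀ β) ε)) :
    HasSum (codingTerm β 1 ε) (toralEnd (extensionMatrix β) (phi₀ β ε)) := by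
  simpa only [Function.comp_def, toralEnd_extensionMatrix_codingTerm hβ, phi₀, coding] using
    hε.hasSum.map (toralEnd (extensionMatrix β)) (continuous_toralEnd _)

theorem summable_codingTerm_xi₀ (hβ : IsPisotUnit β) {ε : ℤ → ℕ} (hε : ε ∈ compactum β) :
    Summable (codingTerm β (xi₀ β) ε) :=
  (hasSum_codingTerm_xi₀ hβ (fun k => digit_le_of_mem_compactum hε k) 0).summable

theorem phi_eq_toralEnd_phi₀ (hβ : IsPisotUnit β) {ε : ℤ → ℕ} (hε : ε ∈ compactum β) :
    phi β ε = toralEnd (extensionMatrix β) (phi₀ β ε) :=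
  (hasSum_codingTerm_one hβ (summable_codingTerm_xi₀ hβ hε)).tsum_eq

theorem eq_toralEnd_of_isValue (hβ : IsPisotUnit β) {x y : Torus (deg β)} (h : IsValue β x y) :
    y = toralEnd (extensionMatrix β) x := by
  obtain ⟨ε, hε, rfl, rfl⟩ := h
  exact phi_eq_toralEnd_phi₀ hβ hε

theorem ae_isValue_toralEnd (hβ : IsPisotUnit β) :
    ∀ᵐ x ∂(volume : Measure (Torus (deg β))), IsValue β x (toralEnd (extensionMatrix β) x) := by
  filter_upwards [ae_mem_phi₀_image_compactum hβ] with x ⟨ε, hε, hx⟩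
  exact ⟨ε, hε, hx, hx ▸ phi_eq_toralEnd_phi₀ hβ hε⟩

theorem isContinuousExtension_iff (hβ : IsPisotUnit β) {A : Torus (deg β) → Torus (deg β)} :
    IsContinuousExtension β A ↔ A = toralEnd (extensionMatrix β) := by
  have hcont := continuous_toralEnd (extensionMatrix β)
  refine ⟨fun hA => (hA.1.ae_eq_iff_eq volume hcont).1 ?_, fun hA => ?_⟩
  · exact hA.2.mono fun _ => eq_toralEnd_of_isValue hβ
  · exact hA ▸ ⟨hcont, ae_isValue_toralEnd hβ⟩

theorem det_extensionMatrix (hβ : IsIntegral ℤ β) {b : Fin (deg β) → ℂ}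
    (hb : (charPol β).map (algebraMap ℤ ℂ) = ∏ i, (X - C (b i))) :
    ((extensionMatrix β).det : ℂ) = discriminant b ∨
      ((extensionMatrix β).det : ℂ) = -discriminant b := by
  rw [extensionMatrix, det_aeval_companion hβ hb, prod_aeval_derivative hb]
  rcases neg_one_pow_eq_or ℂ (∑ i : Fin (deg β), (Finset.Ioi i).card) with h | h <;>
    simp [h, -Fin.card_Ioi]

end Extension

end PisotCoding

end

open PisotCoding in
theorem lemma3p3_general (β : ℝ) (hβ : IsPisotUnit β) (b : Fin (deg β) → ℂ)
    (hb : (charPol β).map (Int.castRingHom ℂ) = ∏ i, (X - C (b i))) :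
    (∀ ε ∈ compactum β, Summable (codingTerm β (xi₀ β) ε) ∧ Summable (codingTerm β 1 ε)) ∧
    (∀ᵐ x ∂(volume : Measure (Torus (deg β))), ∃! y, IsValue β x y) ∧
    ∃ A : Torus (deg β) → Torus (deg β),
      IsContinuousExtension β A ∧
      (∀ A', IsContinuousExtension β A' → A' = A) ∧
      ∃ N : Matrix (Fin (deg β)) (Fin (deg β)) ℤ,
        A = ⇑(toralEnd N) ∧
        (∀ N', A = ⇑(toralEnd N') → N' = N) ∧
        (xi₀ β)⁻¹ = aeval β (derivative (charPol β)) ∧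
        (∀ p : ℤ[X], aeval β p = (xi₀ β)⁻¹ →
          A = ⇑(aeval (T β) p) ∧ N = aeval (companion β) p) ∧
        ((N.det : ℂ) = discriminant b ∨ (N.det : ℂ) = -discriminant b) := by
  refine ⟨fun ε hε => ?_, ?_, toralEnd (extensionMatrix β), (isContinuousExtension_iff hβ).2 rfl,
    fun _ => (isContinuousExtension_iff hβ).1, extensionMatrix β, rfl,
    fun N' hN' => toralEnd_injective (DFunLike.coe_injective hN'.symm), inv_xi₀ β, fun p hp => ?_,
    det_extensionMatrix hβ.isIntegral hb⟩
  · have hsum := summable_codingTerm_xi₀ hβ hε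
    exact ⟨hsum, (hasSum_codingTerm_one hβ hsum).summable⟩
  · filter_upwards [ae_isValue_toralEnd hβ] with x hx
    exact ⟨_, hx, fun y => eq_toralEnd_of_isValue hβ⟩
  · have hN : extensionMatrix β = aeval (companion β) p :=
      aeval_companion_congr hβ.isIntegral ((inv_xi₀ β).symm.trans hp.symm)
    exact ⟨by rw [T, aeval_toralEnd, hN], hN⟩

theorem lemma3p3 (β : ℝ) (hβ : PisotCoding.IsPisotUnit β) (hfin : PisotCoding.IsFinitary β)
    -- the conjugates of `β`
    (b : Fin (PisotCoding.deg β) → ℂ)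
    (hb : (PisotCoding.charPol β).map (Int.castRingHom ℂ) = ∏ i, (X - C (b i))) :
    -- `φ₀` and `φ` are given by convergent series
    (∀ ε ∈ PisotCoding.compactum β,
      Summable (PisotCoding.codingTerm β (PisotCoding.xi₀ β) ε) ∧
        Summable (PisotCoding.codingTerm β 1 ε)) ∧
    -- `φ ∘ φ₀⁻¹` is well defined almost everywhere
    (∀ᵐ x ∂(volume : Measure (PisotCoding.Torus (PisotCoding.deg β))),
      ∃! y, PisotCoding.IsValue β x y) ∧
    -- it has exactly one continuous extension `A`, an endomorphism with a unique matrix `N`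
    ∃ A : PisotCoding.Torus (PisotCoding.deg β) → PisotCoding.Torus (PisotCoding.deg β),
      PisotCoding.IsContinuousExtension β A ∧
      (∀ A', PisotCoding.IsContinuousExtension β A' → A' = A) ∧
      ∃ N : Matrix (Fin (PisotCoding.deg β)) (Fin (PisotCoding.deg β)) ℤ,
        A = ⇑(PisotCoding.toralEnd N) ∧
        (∀ N', A = ⇑(PisotCoding.toralEnd N') → N' = N) ∧
        -- `A = p(T)` whenever `p(β) = ξ₀⁻¹ = g'(β)`; in particular for `p = g'`
        (PisotCoding.xi₀ β)⁻¹ = aeval β (derivative (PisotCoding.charPol β)) ∧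
        (∀ p : ℤ[X], aeval β p = (PisotCoding.xi₀ β)⁻¹ →
          A = ⇑(aeval (PisotCoding.T β) p) ∧ N = aeval (PisotCoding.companion β) p) ∧
        ((N.det : ℂ) = PisotCoding.discriminant b ∨
          (N.det : ℂ) = -PisotCoding.discriminant b) :=
  lemma3p3_general β hβ b hb
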